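/- Let $R$ be a valuation ring (a commutative integral domain in which, of any two elements, one divides the other) whose residue field $k$ is infinite. An $R$-algebra means an $R$-module $A$ with an $R$-bilinear multiplication $A\times A\to A$, not assumed associative, commutative or unital; put $Z(A)=\{x\in A\mid xA=Ax=\{0\}\}$. Let $(A_i)_{i\in I}$ be a family of $R$-algebras, $B$ an $R$-algebra that is torsion-free as an $R$-module, and $f:A=\prod_{i\in I}A_i\to B$ a surjective homomorphism of $R$-algebras. Let $\mathrm{rk}_R(B)$ be the rank of $B$, i.e. the common cardinality of all maximal $R$-linearly independent subsets of $B$. Suppose that either (i) $\mathrm{rk}_R(B)<\mathrm{card}(k)$, or (ii) $\mathrm{rk}_R(B)<2^{\aleph_0}$. Then the composite homomorphism $A\to B\to B/Z(B)$ can be factored, by homomorphisms of $R$-algebras, as $$A\to A/\mathcal U_0\times\dots\times A/\mathcal U_{n-1}\to B/Z(B)$$ for some $n\ge 0$, where the $\mathcal U_m$ are ultrafilters on $I$, which are $\mathrm{card}(k)^+$-complete in case (i) and countably complete (that is, $\aleph_1$-complete) in case (ii). Here $A/\mathcal U$ is the ultraproduct, i.e. the quotient of $A$ by the relation $\{i\mid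 a_i=b_i\}\in\mathcal U$, the first arrow is the product of the quotient maps, and a filter is called $\kappa$-complete if it is closed under intersections of fewer than $\kappa$ members. Call an infinite cardinal $\kappa$ measurable if there is a nonprincipal $\kappa$-complete ultrafilter on $\kappa$ (so $\aleph_0$ is measurable). If, in case (i), $\mathrm{card}(I)$ is less than every measurable cardinal $>\mathrm{card}(k)$, or, in case (ii), $\mathrm{card}(I)$ is less than every uncountable measurable cardinal, then there is a finite subset $J\subseteq I$ such that $A\to B\to B/Z(B)$ factors, by homomorphisms of $R$-algebras, through the projection $A\to\prod_{i\in J}A_i$, and such that $f=f_1+f_0$ for some $R$-algebra homomorphism $f_1:A\to B$ that factors through the same projection and some $R$-algebra homomorphism $f_0:A\to Z(B)$. -/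

import Mathlib

open Cardinal

universe u v w x

/-- A two-sided ideal of a (not necessarily associative, commutative or unital) `R`-algebra. -/
structure AlgIdeal (R : Type u) (A : Type v) [CommRing R] [NonUnitalNonAssocRing A]
    [Module R A] extends Submodule R A where
  mul_left_mem' : ∀ (a : A) {b : A}, b ∈ carrier → a * b ∈ carrier
  mul_right_mem' : ∀ {a : A} (b : A), a ∈ carrier → a * b ∈ carrier

namespace AlgIdeal

section Quotient

variable {R : Type u} {A : Type v} [CommRing R] [NonUnitalNonAssocRing A] [Module R A]

/-- The quotient algebra `A / J`. -/
def Quot (J : AlgIdeal R A) : Type v := A ⧸ J.toSubmodule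

instance (J : AlgIdeal R A) : AddCommGroup J.Quot :=
  inferInstanceAs (AddCommGroup (A ⧸ J.toSubmodule))

instance (J : AlgIdeal R A) : Module R J.Quot :=
  inferInstanceAs (Module R (A ⧸ J.toSubmodule))

/-- The quotient map, as an `R`-linear map. -/
def mkₗ (J : AlgIdeal R A) : A →ₗ[R] J.Quot := J.toSubmodule.mkQ

theorem mkₗ_surjective (J : AlgIdeal R A) : Function.Surjective J.mkₗ :=
  J.toSubmodule.mkQ_surjective

theorem mkₗ_eq_iff (J : AlgIdeal R A) (a b : A) :
    J.mkₗ a = J.mkₗ b ↔ a - b ∈ J.toSubmodule :=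
  Submodule.Quotient.eq J.toSubmodule

/-- Multiplication of cosets, induced by the multiplication of representatives. -/
instance (J : AlgIdeal R A) : Mul J.Quot where
  mul := Quotient.map₂ (· * ·) (by
    intro a a' ha b b' hb
    replace ha := (Submodule.quotientRel_def _).1 ha
    replace hb := (Submodule.quotientRel_def _).1 hb
    refine (Submodule.quotientRel_def _).2 ?_
    have h : a * b - a' * b' = (a - a') * b + a' * (b - b') := by
      rw [sub_mul, mul_sub]; abel
    rw [h]
    exact J.add_mem (J.mul_right_mem' b ha) (J.mul_left_mem' a' hb))

theorem mkₗ_mul (J : AlgIdeal R A) (a b : A) : J.mkₗ (a * b) = J.mkₗ a * J.mkₗ b := rfl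

instance (J : AlgIdeal R A) : NonUnitalNonAssocRing J.Quot where
  left_distrib p q r := by
    obtain ⟨a, rfl⟩ := J.mkₗ_surjective p
    obtain ⟨b, rfl⟩ := J.mkₗ_surjective q
    obtain ⟨c, rfl⟩ := J.mkₗ_surjective r
    simp only [← map_add, ← mkₗ_mul, mul_add]
  right_distrib p q r := by
    obtain ⟨a, rfl⟩ := J.mkₗ_surjective p
    obtain ⟨b, rfl⟩ := J.mkₗ_surjective q
    obtain ⟨c, rfl⟩ := J.mkₗ_surjective r
    simp only [← map_add, ← mkₗ_mul, add_mul]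
  zero_mul p := by
    obtain ⟨a, rfl⟩ := J.mkₗ_surjective p
    rw [← map_zero J.mkₗ, ← mkₗ_mul, zero_mul]
  mul_zero p := by
    obtain ⟨a, rfl⟩ := J.mkₗ_surjective p
    rw [← map_zero J.mkₗ, ← mkₗ_mul, mul_zero]

instance (J : AlgIdeal R A) [IsScalarTower R A A] : IsScalarTower R J.Quot J.Quot where
  smul_assoc r p q := by
    obtain ⟨a, rfl⟩ := J.mkₗ_surjective p
    obtain ⟨b, rfl⟩ := J.mkₗ_surjective q
    simp only [smul_eq_mul, ← map_smul, ← mkₗ_mul, smul_mul_assoc]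

instance (J : AlgIdeal R A) [SMulCommClass R A A] : SMulCommClass R J.Quot J.Quot where
  smul_comm r p q := by
    obtain ⟨a, rfl⟩ := J.mkₗ_surjective p
    obtain ⟨b, rfl⟩ := J.mkₗ_surjective q
    simp only [smul_eq_mul, ← map_smul, ← mkₗ_mul, mul_smul_comm]

/-- The quotient map `A → A / J`, as a homomorphism of `R`-algebras. -/
def quotMk (J : AlgIdeal R A) : A →ₙₐ[R] J.Quot where
  toFun := J.mkₗ
  map_smul' := J.mkₗ.map_smul
  map_zero' := J.mkₗ.map_zero
  map_add' := J.mkₗ.map_add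
  map_mul' := J.mkₗ_mul

end Quotient

end AlgIdeal

section Annihilator

variable (R : Type u) (B : Type v) [CommRing R] [NonUnitalNonAssocRing B] [Module R B]
  [IsScalarTower R B B] [SMulCommClass R B B]

/-- The total annihilator ideal `Z(B) = {x | xB = Bx = {0}}`. -/
def totalAnnihilator : AlgIdeal R B where
  carrier := {x | ∀ y : B, x * y = 0 ∧ y * x = 0}
  zero_mem' y := by simp
  add_mem' {a b} ha hb y := by
    simp [add_mul, mul_add, (ha y).1, (ha y).2, (hb y).1, (hb y).2]
  smul_mem' r a ha y := by
    simp [smul_mul_assoc, mul_smul_comm, (ha y).1, (ha y).2]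
  mul_left_mem' a b hb y := by
    simp [(hb a).2]
  mul_right_mem' {a} b ha y := by
    simp [(ha b).1]

/-- `Z(B)` as a subalgebra of `B`, hence as an algebra in its own right. -/
def totalAnnihilatorSubalgebra : NonUnitalSubalgebra R B where
  toSubmodule := (totalAnnihilator R B).toSubmodule
  mul_mem' {a _} _ hb := (totalAnnihilator R B).mul_left_mem' a hb

end Annihilator

section ReducedProduct

variable (R : Type u) {I : Type v} (A : I → Type w) [CommRing R]
  [∀ i, NonUnitalNonAssocRing (A i)] [∀ i, Module R (A i)]

/-- The ideal of those elements of `∏ i, A i` that vanish on a member of the filter `F`;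
thus `a ≡ b` modulo this ideal iff `{i | a i = b i} ∈ F`. -/
def reducedIdeal (F : Filter I) : AlgIdeal R (∀ i, A i) where
  carrier := {a | {i | a i = 0} ∈ F}
  zero_mem' := by simp
  add_mem' {a b} ha hb := by
    filter_upwards [ha, hb] with i hi hi'
    simp_all
  smul_mem' r a ha := by
    filter_upwards [ha] with i hi
    simp_all
  mul_left_mem' a b hb := by
    filter_upwards [hb] with i hi
    simp_all
  mul_right_mem' {a} b ha := by
    filter_upwards [ha] with i hi
    simp_all

/-- The ultraproduct `(∏ i, A i) / U`, as an `R`-algebra. -/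
abbrev Ultraproduct (U : Ultrafilter I) : Type (max v w) :=
  (reducedIdeal R A (U : Filter I)).Quot

/-- The quotient map from `∏ i, A i` to the ultraproduct. -/
abbrev Ultraproduct.mk (U : Ultrafilter I) : (∀ i, A i) →ₙₐ[R] Ultraproduct R A U :=
  (reducedIdeal R A (U : Filter I)).quotMk

end ReducedProduct

/-- A filter is `κ`-complete if it is closed under intersections of fewer than `κ` members.
(The cardinal `κ` may live in another universe than the index set.) -/
def Filter.IsCardComplete {I : Type v} (F : Filter I) (κ : Cardinal.{u}) : Prop :=
  ∀ S : Set (Set I), Cardinal.lift.{u} #S < Cardinal.lift.{v} κ → (∀ s ∈ S, s ∈ F) → ⋂₀ S ∈ F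

/-- An infinite cardinal `κ` is measurable if there is a nonprincipal `κ`-complete ultrafilter
on a set of cardinality `κ`. With this convention `ℵ₀` is measurable. -/
def Cardinal.IsMeasurableCard (κ : Cardinal.{v}) : Prop :=
  ℵ₀ ≤ κ ∧ ∃ U : Ultrafilter κ.out, (∀ i, U ≠ pure i) ∧ (U : Filter κ.out).IsCardComplete κ

section Factorization

variable {R : Type u} {I : Type v} {A : I → Type w} {B : Type x} [CommRing R]
  [∀ i, NonUnitalNonAssocRing (A i)] [∀ i, Module R (A i)]
  [NonUnitalNonAssocRing B] [Module R B] [IsScalarTower R B B] [SMulCommClass R B B]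

/-- The composite `∏ i, A i → B → B / Z(B)` factors, by algebra homomorphisms, as
`A → A/U₀ × ⋯ × A/Uₙ₋₁ → B / Z(B)` with `κ`-complete ultrafilters `U₀, …, Uₙ₋₁`. -/
def FactorsThroughUltraproducts (f : (∀ i, A i) →ₙₐ[R] B) (κ : Cardinal.{u}) : Prop :=
  ∃ (n : ℕ) (U : Fin n → Ultrafilter I),
    (∀ m, (U m : Filter I).IsCardComplete κ) ∧
    ∃ h : (∀ m, Ultraproduct R A (U m)) →ₙₐ[R] (totalAnnihilator R B).Quot,
      ∀ a, (totalAnnihilator R B).quotMk (f a) = h (fun m => Ultraproduct.mk R A (U m) a)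

/-- For some finite set `J` of indices, the composite `∏ i, A i → B → B / Z(B)` factors through
the projection to `∏ i ∈ J, A i`, and `f = f₁ + f₀` for algebra homomorphisms `f₁ : A → B` that
factors through the same projection, and `f₀ : A → Z(B)`. -/
def SplitsOverFiniteSubproduct (f : (∀ i, A i) →ₙₐ[R] B) : Prop :=
  ∃ J : Finset I,
    (∃ h : (∀ i : J, A i) →ₙₐ[R] (totalAnnihilator R B).Quot,
      ∀ a, (totalAnnihilator R B).quotMk (f a) = h (fun i => a i)) ∧
    ∃ (f₁ : (∀ i, A i) →ₙₐ[R] B) (f₀ : (∀ i, A i) →ₙₐ[R] totalAnnihilatorSubalgebra R B),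
      (∃ g : (∀ i : J, A i) →ₙₐ[R] B, ∀ a, f₁ a = g (fun i => a i)) ∧
      ∀ a, f a = f₁ a + (f₀ a : B)

end Factorization

/-! Call a set `S` of indices conegligible if `f` sends every family vanishing on `S` into `Z(B)`;
these sets form the filter `annihilatorFilter f`. The goal is to show that only finitely many
ultrafilters refine it and that each is highly complete. A filter is the intersection of the
ultrafilters refining it, so the factorization follows.

The engine is a dimension count, `exists_unit_kernel_of_rank_lt`. If an ultrapower of the residue
field has dimension above the rank of `B`, then every linear map from `T → R` to `B` kills some `r`
whose entries are units almost everywhere. This is applied to `r ↦ f (r·a)`, with `r` pulled back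
along a map from `I` to `T`. If `f (r·a) = 0`, then `f (rs·a) * f b = f (r·a) * f (s·b) = 0` and
likewise on the other side, so `f (rs·a)` lies in `Z(B)` for every `s`. Taking `s` to invert the
units of `r` forces `f a`, or a part of it, into `Z(B)`.

Infinitely many ultrafilters, or one that is insufficiently complete, would give a partition of `I`
contradicting this. Below the relevant measurable cardinals complete ultrafilters are principal,
which leaves a finite set of indices. -/

section Ultrapower

/-! ### Dimensions of ultrapowers of a field. -/

open Filter Polynomial

/-- The `k`-algebra structure on an ultrapower of `k` given by the diagonal embedding. -/
abbrev ultrapowerAlgebra {T : Type v} (U : Ultrafilter T) (k : Type u) [Field k] :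
    Algebra k (Germ (U : Filter T) k) :=
  Algebra.ofModule
    (fun r p q => by
      induction p using Germ.inductionOn
      induction q using Germ.inductionOn
      exact congrArg _ (_root_.funext fun _ => smul_mul_assoc r _ _))
    (fun r p q => by
      induction p using Germ.inductionOn
      induction q using Germ.inductionOn
      exact congrArg _ (_root_.funext fun _ => mul_smul_comm r _ _))

theorem Ultrafilter.notMem_of_finite {T : Type v} {U : Ultrafilter T} (hU : ∀ t, {t} ∉ U)
    {s : Set T} (hs : s.Finite) : s ∉ U := by
  intro h
  obtain ⟨t, -, rfl⟩ := Ultrafilter.eq_pure_of_finite_mem hs h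
  exact hU t (by simp)

theorem aeval_germ {T : Type v} (U : Ultrafilter T) {k : Type u} [Field k] (g : T → k)
    (p : k[X]) :
    letI := ultrapowerAlgebra U k
    aeval (g : Germ (U : Filter T) k) p = ((fun t => p.eval (g t) : T → k) : Germ _ k) := by
  let := ultrapowerAlgebra U k
  induction p using Polynomial.induction_on' with
  | add p q hp hq => rw [map_add, hp, hq]; simp only [eval_add]; rfl
  | monomial n a =>
    rw [aeval_monomial, Algebra.algebraMap_eq_smul_one]
    simp only [eval_monomial]
    have h1 : (a • (1 : Germ (U : Filter T) k)) = ((fun _ => a : T → k) : Germ _ k) := by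
      refine congrArg (Germ.ofFun) (_root_.funext fun t => ?_)
      simp
    rw [h1]
    rfl

/-- The germ of `g` is transcendental: a nonzero polynomial has finitely many roots, and `g` meets
them at finitely many indices. Hence the elements `1 / (g - c)`, for `c` in `k`, are linearly
independent. -/
theorem card_le_rank_ultrapower {T : Type v} {U : Ultrafilter T} (hU : ∀ t, {t} ∉ U)
    {k : Type u} [Field k] {g : T → k} (hg : Function.Injective g) :
    Cardinal.lift.{v} #k ≤ Module.rank k (Germ (U : Filter T) k) := by
  let := ultrapowerAlgebra U k
  have ht : Transcendental k (g : Germ (U : Filter T) k) := by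
    rw [transcendental_iff]
    intro p hp
    rw [aeval_germ] at hp
    by_contra h0
    have hmem : {t | p.eval (g t) = 0} ∈ U := Germ.coe_eq.1 hp
    refine Ultrafilter.notMem_of_finite hU ?_ hmem
    have hfin : {x | p.IsRoot x}.Finite := Polynomial.finite_setOfPred_isRoot h0
    exact hfin.preimage hg.injOn
  have := ht.linearIndependent_sub_inv.cardinal_lift_le_rank
  rwa [Cardinal.lift_umax, Cardinal.lift_id'.{u, v}] at this

/-- Each binary sequence is sent to the germ of codes of its initial segments; distinct sequences
share only finitely many of these. -/
theorem two_power_aleph0_le_mk_germ_nat {U : Ultrafilter ℕ} (hU : ∀ t, {t} ∉ U)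
    (k : Type u) [Infinite k] : 2 ^ ℵ₀ ≤ #(Germ (U : Filter ℕ) k) := by
  let e := Infinite.natEmbedding k
  let F : (ℕ → Bool) → Germ (U : Filter ℕ) k := fun x =>
    ((fun n => e (Encodable.encode ((List.range n).map x)) : ℕ → k) : Germ _ k)
  have hF : Function.Injective F := by
    intro x y hxy
    have hmem : {n | e (Encodable.encode ((List.range n).map x)) =
      e (Encodable.encode ((List.range n).map y))} ∈ U := Germ.coe_eq.1 hxy
    ext1 m
    by_contra hne
    refine Ultrafilter.notMem_of_finite hU ((Set.finite_Iic m).subset ?_) hmem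
    intro n hn
    have h1 : (List.range n).map x = (List.range n).map y :=
      Encodable.encode_injective (e.injective hn)
    by_contra hmn
    rw [Set.mem_Iic, not_le] at hmn
    exact hne (List.map_inj_left.1 h1 m (List.mem_range.2 hmn))
  have := Cardinal.mk_le_of_injective
    ((ULift.up_injective.comp hF).comp ULift.down_injective :
      Function.Injective fun x : ULift.{u} (ℕ → Bool) => (ULift.up.{0} (F x.down)))
  simpa using this

/-- The cardinality of an infinite-dimensional space over an infinite field, and in general an upper
bound for it, is the larger of the dimension and the size of the field. Here the field is too small
to account for it. -/
theorem two_power_aleph0_le_rank_ultrapower {U : Ultrafilter ℕ} (hU : ∀ t, {t} ∉ U)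
    {k : Type u} [Field k] [Infinite k] (hk : #k < 2 ^ ℵ₀) :
    2 ^ ℵ₀ ≤ Module.rank k (Germ (U : Filter ℕ) k) := by
  let b := Module.Free.chooseBasis k (Germ (U : Filter ℕ) k)
  have hcard : 2 ^ ℵ₀ ≤ #(Module.Free.ChooseBasisIndex k (Germ (U : Filter ℕ) k) →₀ k) := by
    rw [← Cardinal.mk_congr b.repr.toEquiv]
    exact two_power_aleph0_le_mk_germ_nat hU k
  have hne : Nonempty (Module.Free.ChooseBasisIndex k (Germ (U : Filter ℕ) k)) :=
    b.index_nonempty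
  rw [mk_finsupp_of_infinite', le_max_iff] at hcard
  rw [← b.mk_eq_rank'']
  exact hcard.resolve_right hk.not_ge

end Ultrapower

/-! ### Kernel elements with unit entries, by comparison of ranks. -/

section UnitKernel

open Filter IsLocalRing

/-- A nonzero finite family in a valuation ring is a scalar multiple of a family in which
some entry is `1`. -/
theorem ValuationRing.exists_eq_mul_of_ne_zero {R : Type u} [CommRing R] [IsDomain R]
    [ValuationRing R] {ι : Type v} (s : Finset ι) (c : ι → R) (hc : ∃ i ∈ s, c i ≠ 0) :
    ∃ (d : R) (e : ι → R), d ≠ 0 ∧ (∀ i ∈ s, c i = d * e i) ∧ ∃ i ∈ s, e i = 1 := by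
  classical
  -- A nonzero entry dividing all the others is the common factor; its own cofactor is `1` by
  -- cancellation.
  have key : ∃ j ∈ s, c j ≠ 0 ∧ ∀ i ∈ s, c j ∣ c i := by
    induction s using Finset.induction_on with
    | empty => simp at hc
    | insert a s ha ih =>
      by_cases hs : ∃ i ∈ s, c i ≠ 0
      · obtain ⟨j, hj, hj0, hdvd⟩ := ih hs
        rcases ValuationRing.dvd_total (c j) (c a) with h | h
        · exact ⟨j, Finset.mem_insert_of_mem hj, hj0, by simpa using ⟨h, hdvd⟩⟩
        · refine ⟨a, Finset.mem_insert_self _ _, fun h0 => hj0 ?_, ?_⟩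
          · rw [h0] at h; exact zero_dvd_iff.1 h
          · simpa using fun i hi => h.trans (hdvd i hi)
      · push Not at hs
        obtain ⟨i, hi, hi0⟩ := hc
        rcases Finset.mem_insert.1 hi with rfl | hi
        · exact ⟨i, Finset.mem_insert_self _ _, hi0, by
            simpa using fun j hj => by rw [hs j hj]; exact dvd_zero _⟩
        · exact absurd (hs i hi) hi0
  obtain ⟨j, hj, hj0, hdvd⟩ := key
  choose! e he using hdvd
  refine ⟨c j, e, hj0, he, j, hj, ?_⟩
  have := he j hj
  exact (mul_eq_left₀ hj0).1 this.symm

/-- Every linear map `R^T → B` kills a family whose entries are units almost everywhere with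
respect to any given nonprincipal ultrafilter. -/
def HasUnitKernel (R : Type u) (B : Type x) (T : Type v) [CommRing R] [AddCommGroup B]
    [Module R B] : Prop :=
  ∀ U : Ultrafilter T, (∀ t, {t} ∉ U) → ∀ φ : (T → R) →ₗ[R] B,
    ∃ r, φ r = 0 ∧ {t | IsUnit (r t)} ∈ U

/-- A basis of the ultrapower is lifted to `T → R`. If no suitable `r` existed, the images of the
lifts in `B` would be independent: in a dependence relation the common factor of the coefficients
cancels, as `B` is torsion-free, leaving a kernel element with some coefficient `1`. Its residue
germ is nonzero, so its entries are units almost everywhere. -/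
theorem exists_unit_kernel_of_rank_lt {R : Type u} [CommRing R] [IsDomain R] [ValuationRing R]
    {B : Type x} [AddCommGroup B] [Module R B] [Module.IsTorsionFree R B] {T : Type v}
    (U : Ultrafilter T)
    (hrank : Cardinal.lift.{max u v} (Module.rank R B) <
      Cardinal.lift.{x} (Module.rank (ResidueField R) (Germ (U : Filter T) (ResidueField R))))
    (φ : (T → R) →ₗ[R] B) : ∃ r, φ r = 0 ∧ {t | IsUnit (r t)} ∈ U := by
  by_contra! hno
  let b := Module.Free.chooseBasis (ResidueField R) (Germ (U : Filter T) (ResidueField R))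
  have hlift : ∀ q : Germ (U : Filter T) (ResidueField R), ∃ y : T → R,
      ((fun t => residue R (y t) : T → ResidueField R) : Germ _ _) = q := by
    intro q
    induction q using Germ.inductionOn with | _ g
    choose y hy using fun t => residue_surjective (g t)
    exact ⟨y, congrArg _ (funext hy)⟩
  choose y hy using fun j => hlift (b j)
  have hli : LinearIndependent R (fun j => φ (y j)) := by
    rw [linearIndependent_iff']
    intro s c hc
    by_contra! hne
    obtain ⟨d, e, hd, hce, j, hj, hej⟩ := ValuationRing.exists_eq_mul_of_ne_zero s c hne
    have hker : φ (∑ i ∈ s, e i • y i) = 0 := by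
      have : d • φ (∑ i ∈ s, e i • y i) = 0 := by
        rw [← hc, map_sum, Finset.smul_sum]
        refine Finset.sum_congr rfl fun i hi => ?_
        rw [map_smul, smul_smul, hce i hi]
      exact (smul_eq_zero.1 this).resolve_left hd
    refine hno _ hker ?_
    have hgerm : ((fun t => residue R ((∑ i ∈ s, e i • y i) t) : T → ResidueField R) :
        Germ (U : Filter T) (ResidueField R)) = ∑ i ∈ s, residue R (e i) • b i := by
      classical
      clear hj hker hce hne hc
      induction s using Finset.induction_on with
      | empty => simp only [Finset.sum_empty, Pi.zero_apply, map_zero]; rfl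
      | insert a s ha ih =>
        rw [Finset.sum_insert ha, Finset.sum_insert ha, ← ih, ← hy a]
        refine congrArg Germ.ofFun (funext fun t => ?_)
        simp
    have hne0 : ∑ i ∈ s, residue R (e i) • b i ≠ 0 := by
      intro h0
      have := linearIndependent_iff'.1 b.linearIndependent s _ h0 j hj
      rw [hej, map_one] at this
      exact one_ne_zero this
    rw [← hgerm] at hne0
    have : {t | residue R ((∑ i ∈ s, e i • y i) t) = 0} ∉ U := fun h =>
      hne0 (Germ.coe_eq.2 h)
    rw [← Ultrafilter.compl_mem_iff_notMem] at this
    refine Filter.mem_of_superset this fun t ht => ?_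
    exact (residue_ne_zero_iff_isUnit _).1 ht
  have := hli.cardinal_lift_le_rank
  rw [b.mk_eq_rank''] at this
  exact this.not_gt hrank

theorem hasUnitKernel_of_rank_lt_card {R : Type u} [CommRing R] [IsDomain R] [ValuationRing R]
    {B : Type x} [AddCommGroup B] [Module R B] [Module.IsTorsionFree R B]
    (hrank : Cardinal.lift.{u} (Module.rank R B) < Cardinal.lift.{x} #(ResidueField R))
    {T : Type v} {g : T → ResidueField R} (hg : Function.Injective g) :
    HasUnitKernel R B T := by
  intro U hU φ
  refine exists_unit_kernel_of_rank_lt U ?_ φ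
  refine lt_of_lt_of_le ?_ (Cardinal.lift_le.2 (card_le_rank_ultrapower hU hg))
  have := Cardinal.lift_lt.{_, v}.2 hrank
  simpa only [Cardinal.lift_lift, Cardinal.lift_umax] using this

theorem hasUnitKernel_nat_of_rank_lt {R : Type u} [CommRing R] [IsDomain R] [ValuationRing R]
    [Infinite (ResidueField R)]
    {B : Type x} [AddCommGroup B] [Module R B] [Module.IsTorsionFree R B]
    (hrank : Module.rank R B < 2 ^ ℵ₀) (hk : #(ResidueField R) < 2 ^ ℵ₀) :
    HasUnitKernel R B ℕ := by
  intro U hU φ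
  refine exists_unit_kernel_of_rank_lt U ?_ φ
  refine lt_of_lt_of_le ?_ (Cardinal.lift_le.2 (two_power_aleph0_le_rank_ultrapower hU hk))
  have := Cardinal.lift_lt.{_, u}.2 hrank
  simpa using this

end UnitKernel

/-- Injectivity keeps the pushed-forward ultrafilter nonprincipal; the kernel element found on `T'`
is then pulled back. -/
theorem HasUnitKernel.of_injective {R : Type u} {B : Type x} [CommRing R] [AddCommGroup B]
    [Module R B] {T : Type v} {T' : Type w} (h : HasUnitKernel R B T') {g : T → T'}
    (hg : Function.Injective g) : HasUnitKernel R B T := by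
  intro U hU φ
  obtain ⟨r, hr, hmem⟩ := h (U.map g) (fun t' ht' => by
    rw [Ultrafilter.mem_map] at ht'
    exact Ultrafilter.notMem_of_finite hU ((Set.finite_singleton t').preimage hg.injOn) ht')
    (φ ∘ₗ LinearMap.funLeft R R g)
  exact ⟨r ∘ g, hr, hmem⟩

/-! ### Separating ultrafilters, and partitions of the index set. -/

section Ultrafilters

open Filter

variable {I : Type v}

theorem Ultrafilter.exists_mem_notMem {U V : Ultrafilter I} (h : U ≠ V) :
    ∃ s, s ∈ U ∧ s ∉ V := by
  by_contra! hall
  refine h (Ultrafilter.ext fun s => ⟨hall s, fun hs => ?_⟩)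
  by_contra hsU
  exact Ultrafilter.compl_mem_iff_notMem.1
    (hall _ (Ultrafilter.compl_mem_iff_notMem.2 hsU)) hs

/-- Finitely many distinct ultrafilters have pairwise disjoint members. -/
theorem Ultrafilter.exists_pairwise_disjoint_mem {n : ℕ} {U : Fin n → Ultrafilter I}
    (hU : Function.Injective U) :
    ∃ S : Fin n → Set I, (∀ m, S m ∈ U m) ∧ Pairwise fun m l => Disjoint (S m) (S l) := by
  have h : ∀ m l, ∃ s, m ≠ l → s ∈ U m ∧ s ∉ U l := fun m l => by
    by_cases hml : m = l
    · exact ⟨∅, fun h => absurd hml h⟩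
    · obtain ⟨s, hs⟩ := Ultrafilter.exists_mem_notMem (hU.ne hml)
      exact ⟨s, fun _ => hs⟩
  choose X hX using h
  refine ⟨fun m => ⋂ l, {i | m ≠ l → i ∈ X m l ∧ i ∉ X l m}, fun m => ?_, fun m l hml => ?_⟩
  · refine Filter.iInter_mem.2 fun l => ?_
    by_cases hml : m = l
    · simp [hml]
    · have h2 := Ultrafilter.compl_mem_iff_notMem.2 (hX l m (Ne.symm hml)).2
      filter_upwards [(hX m l hml).1, h2] with i h1 h2 _
      exact ⟨h1, h2⟩
  · refine Set.disjoint_left.2 fun i hi hi' => ?_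
    exact (Set.mem_iInter.1 hi l hml).2 (Set.mem_iInter.1 hi' m hml.symm).1

/-- If infinitely many ultrafilters refine `F`, then the index set has a countable partition
into sets none of which is negligible for `F`. -/
theorem Filter.exists_nat_partition_of_infinite {F : Filter I}
    (hF : {U : Ultrafilter I | (U : Filter I) ≤ F}.Infinite) :
    ∃ π : I → ℕ, ∀ n, (π ⁻¹' {n})ᶜ ∉ F := by
  classical
  let Big : Set I → Prop := fun S => {U : Ultrafilter I | (U : Filter I) ≤ F ∧ S ∈ U}.Infinite
  -- A set separating two of the ultrafilters cuts `S` in two. One half still lies in infinitely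
  -- many of them; the discarded half lies in at least one, so its complement is not in `F`.
  have hstep : ∀ S, Big S → ∃ S', S' ⊆ S ∧ Big S' ∧ (S \ S')ᶜ ∉ F := by
    intro S hS
    obtain ⟨U, hU, V, hV, hUV⟩ := hS.nontrivial
    obtain ⟨T, hTU, hTV⟩ := Ultrafilter.exists_mem_notMem hUV
    have hsplit : {U : Ultrafilter I | (U : Filter I) ≤ F ∧ S ∈ U} ⊆
        {U : Ultrafilter I | (U : Filter I) ≤ F ∧ S ∩ T ∈ U} ∪
        {U : Ultrafilter I | (U : Filter I) ≤ F ∧ S \ T ∈ U} := by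
      rintro W ⟨hW, hSW⟩
      by_cases hT : T ∈ W
      · exact Or.inl ⟨hW, inter_mem hSW hT⟩
      · exact Or.inr ⟨hW, inter_mem hSW (Ultrafilter.compl_mem_iff_notMem.2 hT)⟩
    rcases Set.infinite_union.1 (hS.mono hsplit) with h | h
    · refine ⟨S ∩ T, Set.inter_subset_left, h, fun hF => ?_⟩
      refine Ultrafilter.compl_mem_iff_notMem.1 (hV.1 hF) ?_
      rw [Set.sdiff_self_inter]
      exact inter_mem hV.2 (Ultrafilter.compl_mem_iff_notMem.2 hTV)
    · refine ⟨S \ T, Set.sdiff_subset, h, fun hF => ?_⟩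
      refine Ultrafilter.compl_mem_iff_notMem.1 (hU.1 hF) ?_
      rw [Set.sdiff_sdiff_right_self]
      exact inter_mem hU.2 hTU
  choose! next hsub hbig hnull using hstep
  let S : ℕ → Set I := fun n => next^[n] Set.univ
  have hsucc : ∀ n, S (n + 1) = next (S n) := fun n => Function.iterate_succ_apply' _ _ _
  have hS : ∀ n, Big (S n) := by
    intro n
    induction n with
    | zero => simpa [Big, S, Filter.univ_mem, ← Ultrafilter.mem_coe] using hF
    | succ n ih => rw [hsucc]; exact hbig _ ih
  have hanti : Antitone S := antitone_nat_of_succ_le fun n => by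
    rw [hsucc]; exact hsub _ (hS n)
  -- The fiber over `n` contains `S n \ S (n + 1)`. Points lying in every `S n` get the value `0`,
  -- which only enlarges that fiber.
  refine ⟨fun i => if h : ∃ n, i ∉ S (n + 1) then Nat.find h else 0, fun n hn => ?_⟩
  refine hnull _ (hS n) (mem_of_superset hn ?_)
  rw [Set.compl_subset_compl]
  rintro i ⟨hi, hi'⟩
  rw [← hsucc] at hi'
  have hex : ∃ n, i ∉ S (n + 1) := ⟨n, hi'⟩
  simp only [Set.mem_preimage, Set.mem_singleton_iff]
  rw [dif_pos hex, Nat.find_eq_iff]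
  exact ⟨hi', fun m hm => not_not.2 (hanti (Nat.succ_le_of_lt hm) hi)⟩

/-- A failure of completeness of an ultrafilter gives a partition into null sets. -/
theorem Ultrafilter.exists_partition_of_sInter_notMem {U : Ultrafilter I} {S : Set (Set I)}
    (hS : ∀ s ∈ S, s ∈ U) (hint : ⋂₀ S ∉ U) : ∃ π : I → S, ∀ s, π ⁻¹' {s} ∉ U := by
  classical
  obtain ⟨s₀, hs₀⟩ : S.Nonempty := by
    rw [Set.nonempty_iff_ne_empty]
    rintro rfl
    exact hint (by rw [Set.sInter_empty]; exact univ_mem)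
  have hex : ∀ i, ∃ s : S, i ∉ ⋂₀ S → i ∉ s.1 := by
    intro i
    by_cases hi : i ∈ ⋂₀ S
    -- Points of the intersection may go anywhere: the fiber over `s`, cut down to `s`, contains
    -- only such points.
    · exact ⟨⟨s₀, hs₀⟩, fun h => absurd hi h⟩
    · rw [Set.mem_sInter] at hi
      push Not at hi
      obtain ⟨s, hs, his⟩ := hi
      exact ⟨⟨s, hs⟩, fun _ => his⟩
  choose π hπ using hex
  refine ⟨π, fun s hs => hint ?_⟩
  filter_upwards [hs, hS s.1 s.2] with i hi his
  by_contra hni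
  obtain rfl : π i = s := hi
  exact hπ i hni his

end Ultrafilters

/-! ### Weighting families by scalar functions. -/

section WeightedMap

variable {R : Type u} {I : Type v} {A : I → Type w} {B : Type x} [CommRing R]
  [∀ i, NonUnitalNonAssocRing (A i)] [∀ i, Module R (A i)]
  [NonUnitalNonAssocRing B] [Module R B]

/-- Weighting a family `a` by the pullback of `r : T → R` along `π`, then applying `f`. -/
def weightedMap (f : (∀ i, A i) →ₙₐ[R] B) {T : Type*} (π : I → T) (a : ∀ i, A i) :
    (T → R) →ₗ[R] B where
  toFun r := f fun i => r (π i) • a i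
  map_add' r s := by
    rw [← map_add]
    exact congrArg f (funext fun i => add_smul _ _ _)
  map_smul' c r := by
    rw [RingHom.id_apply, ← map_smul]
    exact congrArg f (funext fun i => mul_smul _ _ _)

theorem weightedMap_apply (f : (∀ i, A i) →ₙₐ[R] B) {T : Type*} (π : I → T) (a : ∀ i, A i)
    (r : T → R) : weightedMap f π a r = f fun i => r (π i) • a i := rfl

end WeightedMap

/-! ### The annihilator filter: finiteness and completeness of its ultrafilters. -/

section Negligible

open Filter

variable {R : Type u} {I : Type v} {A : I → Type w} {B : Type x} [CommRing R]
  [∀ i, NonUnitalNonAssocRing (A i)] [∀ i, Module R (A i)]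
  [NonUnitalNonAssocRing B] [Module R B] [IsScalarTower R B B] [SMulCommClass R B B]

/-- The filter of those sets `S` such that `f` sends every family vanishing on `S` into the
total annihilator of `B`. -/
def annihilatorFilter (f : (∀ i, A i) →ₙₐ[R] B) : Filter I where
  sets := {S | ∀ a, (∀ i ∈ S, a i = 0) → f a ∈ (totalAnnihilator R B).toSubmodule}
  univ_sets a ha := by
    rw [show a = 0 from funext fun i => ha i trivial, map_zero]
    exact zero_mem _
  sets_of_superset hS hST := by
    intro a ha
    exact hS a fun i hi => ha i (hST hi)
  inter_sets {S T} hS hT a ha := by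
    classical
    have h : a = (fun i => if i ∈ S then 0 else a i) + (fun i => if i ∈ S then a i else 0) := by
      funext i
      by_cases hi : i ∈ S <;> simp [hi]
    rw [h, map_add]
    refine add_mem (hS _ fun i hi => by simp [hi]) (hT _ fun i hi => ?_)
    by_cases hi' : i ∈ S
    · simp [hi', ha i ⟨hi', hi⟩]
    · simp [hi']

theorem mem_annihilatorFilter {f : (∀ i, A i) →ₙₐ[R] B} {S : Set I} :
    S ∈ annihilatorFilter f ↔
      ∀ a, (∀ i ∈ S, a i = 0) → f a ∈ (totalAnnihilator R B).toSubmodule :=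
  Iff.rfl

variable [∀ i, IsScalarTower R (A i) (A i)] [∀ i, SMulCommClass R (A i) (A i)]

/-- The factor `s` moves across the product onto the other argument, and every element of `B` is an
`f b`. -/
theorem weightedMap_mul_mem {f : (∀ i, A i) →ₙₐ[R] B} (hf : Function.Surjective f)
    {T : Type*} (π : I → T) (a : ∀ i, A i) {r : T → R}
    (hr : weightedMap f π a r = 0) (s : T → R) :
    weightedMap f π a (r * s) ∈ (totalAnnihilator R B).toSubmodule := by
  intro y
  obtain ⟨b, rfl⟩ := hf y
  rw [weightedMap_apply] at hr ⊢
  constructor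
  · rw [← zero_mul (f fun i => s (π i) • b i), ← hr, ← map_mul, ← map_mul]
    refine congrArg f (funext fun i => ?_)
    simp only [Pi.mul_apply, smul_mul_assoc, mul_smul_comm, mul_smul]
    rw [smul_comm]
  · rw [← mul_zero (f fun i => s (π i) • b i), ← hr, ← map_mul, ← map_mul]
    refine congrArg f (funext fun i => ?_)
    simp only [Pi.mul_apply, smul_mul_assoc, mul_smul_comm, mul_smul]

/-- Otherwise there is a partition into countably many pieces, each supporting a family not sent
into `Z(B)`. Gluing these families and weighting by a kernel element `r` gives a contradiction at
any `n` where `r n` is a unit. -/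
theorem finite_ultrafilters_le_annihilatorFilter {f : (∀ i, A i) →ₙₐ[R] B}
    (hf : Function.Surjective f) (hker : HasUnitKernel R B ℕ) :
    {U : Ultrafilter I | (U : Filter I) ≤ annihilatorFilter f}.Finite := by
  classical
  by_contra hinf
  obtain ⟨π, hπ⟩ := Filter.exists_nat_partition_of_infinite hinf
  simp only [mem_annihilatorFilter] at hπ
  push Not at hπ
  choose a ha hfa using hπ
  obtain ⟨r, hr, hmem⟩ := hker (hyperfilter ℕ)
    (fun n => notMem_hyperfilter_of_finite (Set.finite_singleton n))
    (weightedMap f π fun i => a (π i) i)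
  obtain ⟨n, hn⟩ := Ultrafilter.nonempty_of_mem hmem
  refine hfa n ?_
  -- The second weight selects piece `n` and cancels `r n`, which recovers the family `a n`.
  convert weightedMap_mul_mem hf π _ hr (Pi.single n (Ring.inverse (r n))) using 1
  rw [weightedMap_apply]
  refine congrArg f (funext fun i => ?_)
  by_cases hi : π i = n
  · subst hi
    simp [Ring.mul_inverse_cancel _ hn]
  · simp [hi, ha n i (by simpa using hi)]

/-- The set `S` isolates `U` among the ultrafilters refining the filter, so a condition true
`U`-almost everywhere holds on `S` up to a negligible set. If all fibers were null, the pushforward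
of `U` would be nonprincipal, and the kernel weight could be inverted on `S`. -/
theorem exists_fiber_mem {f : (∀ i, A i) →ₙₐ[R] B} (hf : Function.Surjective f)
    {T : Type*} (hker : HasUnitKernel R B T) {U : Ultrafilter I}
    (hU : (U : Filter I) ≤ annihilatorFilter f) {S : Set I} (hS : S ∈ U)
    (hS' : ∀ V : Ultrafilter I, (V : Filter I) ≤ annihilatorFilter f → V ≠ U → S ∉ V)
    (π : I → T) : ∃ t, π ⁻¹' {t} ∈ U := by
  classical
  by_contra! hπ
  have hSc : Sᶜ ∉ annihilatorFilter f := fun h =>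
    Ultrafilter.compl_mem_iff_notMem.1 (hU h) hS
  rw [mem_annihilatorFilter] at hSc
  push Not at hSc
  obtain ⟨a, ha, hfa⟩ := hSc
  obtain ⟨r, hr, hmem⟩ := hker (U.map π) hπ (weightedMap f π a)
  rw [Ultrafilter.mem_map] at hmem
  have hnull : {i | i ∈ S → IsUnit (r (π i))} ∈ annihilatorFilter f := by
    rw [Filter.mem_iff_ultrafilter]
    intro V hV
    by_cases hVU : V = U
    · subst hVU
      filter_upwards [hmem] with i hi _ using hi
    · filter_upwards [Ultrafilter.compl_mem_iff_notMem.2 (hS' V hV hVU)] with i hi hi'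
      exact absurd hi' hi
  refine hfa ?_
  have h1 := weightedMap_mul_mem hf π a hr (fun t => Ring.inverse (r t))
  -- `Ring.inverse` is `0` at nonunits, so the weight `r * Ring.inverse r` is `1` at units and `0`
  -- elsewhere; the difference vanishes on the set of `hnull`.
  have h2 := hnull (a - fun i => (r (π i) * Ring.inverse (r (π i))) • a i) fun i hi => by
    by_cases hiS : i ∈ S
    · simp [Ring.mul_inverse_cancel _ (hi hiS)]
    · simp [ha i hiS]
  have := add_mem h1 h2
  rw [weightedMap_apply, ← map_add] at this
  convert this using 2
  funext i
  simp

/-- The ultrafilters refining `annihilatorFilter f` are finitely many and complete. -/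
theorem exists_complete_ultrafilters {f : (∀ i, A i) →ₙₐ[R] B} (hf : Function.Surjective f)
    (hnat : HasUnitKernel R B ℕ) (κ : Cardinal.{u})
    (hker : ∀ T : Type v, Cardinal.lift.{u} #T < Cardinal.lift.{v} κ → HasUnitKernel R B T) :
    ∃ (n : ℕ) (U : Fin n → Ultrafilter I), Function.Injective U ∧
      (∀ m, (U m : Filter I).IsCardComplete κ) ∧
      ∀ s, (∀ m, s ∈ U m) → s ∈ annihilatorFilter f := by
  have hfin := finite_ultrafilters_le_annihilatorFilter hf hnat
  obtain ⟨n, U, hUinj, hUrange⟩ := hfin.fin_param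
  have hle : ∀ m, (U m : Filter I) ≤ annihilatorFilter f := fun m => by
    have : U m ∈ Set.range U := ⟨m, rfl⟩
    rwa [hUrange] at this
  have hex : ∀ V : Ultrafilter I, (V : Filter I) ≤ annihilatorFilter f → ∃ m, U m = V :=
    fun V hV => by
      have : V ∈ Set.range U := by rw [hUrange]; exact hV
      exact this
  refine ⟨n, U, hUinj, fun m 𝒮 hcard h𝒮 => ?_, fun s hs => ?_⟩
  · obtain ⟨S, hS, hdisj⟩ := Ultrafilter.exists_pairwise_disjoint_mem hUinj
    by_contra hint
    obtain ⟨π, hπ⟩ := Ultrafilter.exists_partition_of_sInter_notMem h𝒮 hint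
    have hker' : HasUnitKernel R B 𝒮 := hker _ hcard
    obtain ⟨t, ht⟩ := exists_fiber_mem hf hker' (hle m) (hS m) (fun V hV hVU hSV => by
      obtain ⟨l, rfl⟩ := hex V hV
      have hlm : l ≠ m := fun h => hVU (h ▸ rfl)
      have := inter_mem (hS l) hSV
      rw [(hdisj hlm).inter_eq] at this
      exact Ultrafilter.empty_notMem this) π
    exact hπ t ht
  · rw [Filter.mem_iff_ultrafilter]
    intro V hV
    obtain ⟨m, rfl⟩ := hex V hV
    exact hs m

end Negligible

/-! ### Measurable cardinals from complete nonprincipal ultrafilters. -/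

section Measurable

open Filter

variable {I : Type v}

/-- A nonprincipal `κ⁺`-complete ultrafilter on `I`, with `κ` infinite, yields a measurable
cardinal `μ` with `κ < μ ≤ #I`. -/
theorem exists_isMeasurableCard_of_isCardComplete {U : Ultrafilter I} (hU : ∀ i, U ≠ pure i)
    {κ : Cardinal.{u}} (hκ : ℵ₀ ≤ κ) (hc : (U : Filter I).IsCardComplete (Order.succ κ)) :
    ∃ μ : Cardinal.{v}, μ.IsMeasurableCard ∧
      Cardinal.lift.{v} κ < Cardinal.lift.{u} μ ∧ μ ≤ #I := by
  have hsing : ∀ i, {i} ∉ U := fun i hi => by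
    obtain ⟨j, -, rfl⟩ := Ultrafilter.eq_pure_of_finite_mem (Set.finite_singleton i) hi
    exact hU j rfl
  -- The measurable cardinal is the least size of an index set for a partition into `U`-null fibers.
  -- Minimality gives completeness, and pushing `U` forward along a minimal partition gives the
  -- ultrafilter on it.
  let P : Set Cardinal.{v} := {c | ∃ π : I → c.out, ∀ j, π ⁻¹' {j} ∉ U}
  have hI : #I ∈ P := by
    obtain ⟨e⟩ := Cardinal.eq.1 (Cardinal.mk_out #I)
    refine ⟨e.symm, fun j => ?_⟩
    have h : e.symm ⁻¹' {j} = {e j} := by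
      ext i
      simp [Equiv.symm_apply_eq]
    rw [h]
    exact hsing _
  have hmem : sInf P ∈ P := csInf_mem ⟨_, hI⟩
  have hle : sInf P ≤ #I := csInf_le' hI
  have hcomp : (U : Filter I).IsCardComplete (sInf P) := by
    intro S hS hSU
    rw [Cardinal.lift_lt] at hS
    by_contra hint
    obtain ⟨π, hπ⟩ := Ultrafilter.exists_partition_of_sInter_notMem hSU hint
    refine (csInf_le' (?_ : #S ∈ P)).not_gt hS
    obtain ⟨e⟩ := Cardinal.eq.1 (Cardinal.mk_out #S)
    refine ⟨fun i => e.symm (π i), fun j => ?_⟩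
    have h : (fun i => e.symm (π i)) ⁻¹' {j} = π ⁻¹' {e j} := by
      ext i
      simp [Equiv.symm_apply_eq]
    rw [h]
    exact hπ _
  have hlt : Cardinal.lift.{v} κ < Cardinal.lift.{u} (sInf P) := by
    by_contra! hge
    obtain ⟨π, hπ⟩ := hmem
    -- With at most `κ` null fibers, their complements would be too few for their empty intersection
    -- to escape completeness.
    have hcard : Cardinal.lift.{u} #(Set.range fun j => (π ⁻¹' {j})ᶜ) <
        Cardinal.lift.{v} (Order.succ κ) := by
      rw [Cardinal.lift_succ, Order.lt_succ_iff]
      refine le_trans (Cardinal.lift_le.2 ?_) hge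
      exact Cardinal.mk_range_le.trans (Cardinal.mk_out _).le
    have := hc _ hcard (by
      rintro _ ⟨j, rfl⟩
      exact Ultrafilter.compl_mem_iff_notMem.2 (hπ j))
    have hempty : ⋂₀ (Set.range fun j => (π ⁻¹' {j})ᶜ) = ∅ := by
      ext i
      simp
    rw [hempty] at this
    exact Ultrafilter.empty_notMem this
  refine ⟨sInf P, ⟨?_, ?_⟩, hlt, hle⟩
  · have : ℵ₀ ≤ Cardinal.lift.{u} (sInf P) := le_trans (by simpa using hκ) hlt.le
    exact Cardinal.aleph0_le_lift.1 this
  · obtain ⟨π, hπ⟩ := hmem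
    refine ⟨U.map π, fun j hj => hπ j ?_, fun S hS hSU => ?_⟩
    · have : ({j} : Set _) ∈ U.map π := by rw [hj]; exact rfl
      exact this
    · have := hcomp (Set.image (Set.preimage π) S) ?_ ?_
      · change π ⁻¹' ⋂₀ S ∈ (U : Filter I)
        refine Filter.mem_of_superset this fun i hi s hs => ?_
        exact hi _ ⟨s, hs, rfl⟩
      · rw [Cardinal.lift_lt] at hS ⊢
        exact Cardinal.mk_image_le.trans_lt hS
      · rintro _ ⟨s, hs, rfl⟩
        exact hSU s hs

end Measurable

/-! ### Factorization through ultraproducts and through finite subproducts. -/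

section Factor

open Filter

/-- An algebra homomorphism factors through any surjection whose kernel it kills. -/
theorem NonUnitalAlgHom.exists_factor_of_surjective {R : Type*} {P Q C : Type*} [CommRing R]
    [NonUnitalNonAssocRing P] [Module R P] [NonUnitalNonAssocRing Q] [Module R Q]
    [NonUnitalNonAssocRing C] [Module R C] (ψ : P →ₙₐ[R] Q) (hψ : Function.Surjective ψ)
    (g : P →ₙₐ[R] C) (hker : ∀ p, ψ p = 0 → g p = 0) :
    ∃ h : Q →ₙₐ[R] C, ∀ p, g p = h (ψ p) := by
  have heq : ∀ p p', ψ p = ψ p' → g p = g p' := fun p p' h => by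
    rw [← sub_eq_zero, ← map_sub]
    exact hker _ (by rw [map_sub, h, sub_self])
  have hinv : ∀ p, g (Function.surjInv hψ (ψ p)) = g p := fun p =>
    heq _ _ (Function.surjInv_eq hψ _)
  refine ⟨{ toFun := fun q => g (Function.surjInv hψ q)
            map_smul' := fun r q => ?_
            map_zero' := ?_
            map_add' := fun q q' => ?_
            map_mul' := fun q q' => ?_ }, fun p => (hinv p).symm⟩
  · obtain ⟨p, rfl⟩ := hψ q
    rw [← map_smul]
    simp only [hinv]
    exact map_smul g r p
  · rw [← map_zero ψ]
    simp only [hinv]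
    exact map_zero g
  · obtain ⟨p, rfl⟩ := hψ q
    obtain ⟨p', rfl⟩ := hψ q'
    rw [← map_add]
    simp only [hinv]
    exact map_add g p p'
  · obtain ⟨p, rfl⟩ := hψ q
    obtain ⟨p', rfl⟩ := hψ q'
    rw [← map_mul]
    simp only [hinv]
    exact map_mul g p p'

section ToProd

variable (R : Type u) {I : Type v} (A : I → Type w) [CommRing R]
  [∀ i, NonUnitalNonAssocRing (A i)] [∀ i, Module R (A i)]

/-- The canonical map from a product to a product of ultraproducts. -/
def Ultraproduct.toPi {n : ℕ} (U : Fin n → Ultrafilter I) :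
    (∀ i, A i) →ₙₐ[R] ∀ m, Ultraproduct R A (U m) where
  toFun a m := Ultraproduct.mk R A (U m) a
  map_smul' r a := funext fun m => map_smul (Ultraproduct.mk R A (U m)) r a
  map_zero' := funext fun m => map_zero (Ultraproduct.mk R A (U m))
  map_add' a b := funext fun m => map_add (Ultraproduct.mk R A (U m)) a b
  map_mul' a b := funext fun m => map_mul (Ultraproduct.mk R A (U m)) a b

theorem Ultraproduct.mk_eq_iff (U : Ultrafilter I) (a b : ∀ i, A i) :
    Ultraproduct.mk R A U a = Ultraproduct.mk R A U b ↔ {i | a i = b i} ∈ U := by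
  refine (AlgIdeal.mkₗ_eq_iff _ a b).trans ?_
  change {i | (a - b) i = 0} ∈ U ↔ _
  simp only [Pi.sub_apply, sub_eq_zero]

/-- Representatives of the coordinates are glued along pairwise disjoint members of the
ultrafilters. -/
theorem Ultraproduct.toPi_surjective {n : ℕ} {U : Fin n → Ultrafilter I}
    (hU : Function.Injective U) : Function.Surjective (Ultraproduct.toPi R A U) := by
  classical
  intro q
  obtain ⟨S, hS, hdisj⟩ := Ultrafilter.exists_pairwise_disjoint_mem hU
  choose a ha using fun m => AlgIdeal.mkₗ_surjective (reducedIdeal R A (U m : Filter I)) (q m)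
  refine ⟨fun i => if h : ∃ m, i ∈ S m then a h.choose i else 0, funext fun m => ?_⟩
  rw [← ha m]
  refine (Ultraproduct.mk_eq_iff R A (U m) _ (a m)).2 ?_
  filter_upwards [hS m] with i hi
  have hex : ∃ m, i ∈ S m := ⟨m, hi⟩
  have : hex.choose = m := by
    by_contra hne
    exact Set.disjoint_left.1 (hdisj hne) hex.choose_spec hi
  rw [dif_pos hex, this]

/-- Restriction of a family to a set of indices, extended by zero. -/
noncomputable def piRestrict (S : Set I) : (∀ i, A i) →ₙₐ[R] ∀ i, A i :=
  open Classical in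
  { toFun := fun a i => if i ∈ S then a i else 0
    map_smul' := fun r a => funext fun i => by by_cases h : i ∈ S <;> simp [h]
    map_zero' := funext fun i => by simp
    map_add' := fun a b => funext fun i => by by_cases h : i ∈ S <;> simp [h]
    map_mul' := fun a b => funext fun i => by by_cases h : i ∈ S <;> simp [h] }

/-- Extension by zero from a subproduct. -/
noncomputable def piExtend (J : Finset I) : (∀ i : J, A i) →ₙₐ[R] ∀ i, A i :=
  open Classical in
  { toFun := fun a i => if h : i ∈ J then a ⟨i, h⟩ else 0
    map_smul' := fun r a => funext fun i => by by_cases h : i ∈ J <;> simp [h]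
    map_zero' := funext fun i => by simp
    map_add' := fun a b => funext fun i => by by_cases h : i ∈ J <;> simp [h]
    map_mul' := fun a b => funext fun i => by by_cases h : i ∈ J <;> simp [h] }

theorem piRestrict_apply_of_notMem {S : Set I} (a : ∀ i, A i) {i : I} (hi : i ∉ S) :
    piRestrict R A S a i = 0 := if_neg hi

theorem piExtend_add_piRestrict_compl (J : Finset I) (a : ∀ i, A i) :
    piExtend R A J (fun i => a i) + piRestrict R A (J : Set I)ᶜ a = a := by
  funext i
  by_cases h : i ∈ J <;> simp [piExtend, piRestrict, h]

end ToProd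

variable {R : Type u} {I : Type v} {A : I → Type w} {B : Type x} [CommRing R]
  [∀ i, NonUnitalNonAssocRing (A i)] [∀ i, Module R (A i)]
  [NonUnitalNonAssocRing B] [Module R B] [IsScalarTower R B B] [SMulCommClass R B B]

theorem quotMk_eq_zero_iff (b : B) :
    (totalAnnihilator R B).quotMk b = 0 ↔ b ∈ (totalAnnihilator R B).toSubmodule := by
  have := AlgIdeal.mkₗ_eq_iff (totalAnnihilator R B) b 0
  rwa [map_zero, sub_zero] at this

theorem factorsThroughUltraproducts_of_forall_mem {f : (∀ i, A i) →ₙₐ[R] B} {κ : Cardinal.{u}}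
    {n : ℕ} {U : Fin n → Ultrafilter I} (hinj : Function.Injective U)
    (hcomp : ∀ m, (U m : Filter I).IsCardComplete κ)
    (hU : ∀ s, (∀ m, s ∈ U m) → s ∈ annihilatorFilter f) :
    FactorsThroughUltraproducts f κ := by
  obtain ⟨h, hh⟩ := NonUnitalAlgHom.exists_factor_of_surjective (Ultraproduct.toPi R A U)
    (Ultraproduct.toPi_surjective R A hinj) ((totalAnnihilator R B).quotMk.comp f) (fun a ha => by
      refine (quotMk_eq_zero_iff _).2 (hU {i | a i = 0} (fun m => ?_) a fun i hi => hi)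
      refine (Ultraproduct.mk_eq_iff R A (U m) a 0).1 ?_
      rw [map_zero]
      exact congrFun ha m)
  exact ⟨n, U, hcomp, h, hh⟩

/-- Restriction to `J` and to its complement are algebra endomorphisms of the product with sum the
identity; composing them with `f` gives `f₁` and `f₀`. -/
theorem splitsOverFiniteSubproduct_of_mem {f : (∀ i, A i) →ₙₐ[R] B} {J : Finset I}
    (hJ : (J : Set I) ∈ annihilatorFilter f) : SplitsOverFiniteSubproduct f := by
  have hZ : ∀ a, f (piRestrict R A (J : Set I)ᶜ a) ∈ (totalAnnihilator R B).toSubmodule :=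
    fun a => hJ _ fun i hi => piRestrict_apply_of_notMem R A a (not_not.2 hi)
  have hsum : ∀ a, f a =
      f (piExtend R A J fun i => a i) + f (piRestrict R A (J : Set I)ᶜ a) := fun a => by
    rw [← map_add, piExtend_add_piRestrict_compl]
  let pr : (∀ i, A i) →ₙₐ[R] ∀ i : J, A i :=
    { toFun := fun a i => a i
      map_smul' := fun _ _ => rfl
      map_zero' := rfl
      map_add' := fun _ _ => rfl
      map_mul' := fun _ _ => rfl }
  refine ⟨J, ⟨((totalAnnihilator R B).quotMk.comp f).comp (piExtend R A J), fun a => ?_⟩,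
    (f.comp (piExtend R A J)).comp pr,
    NonUnitalAlgHom.codRestrict (f.comp (piRestrict R A (J : Set I)ᶜ))
      (totalAnnihilatorSubalgebra R B) hZ,
    ⟨f.comp (piExtend R A J), fun a => rfl⟩, fun a => hsum a⟩
  rw [hsum a, map_add, (quotMk_eq_zero_iff _).2 (hZ a), add_zero]
  rfl

variable [∀ i, IsScalarTower R (A i) (A i)] [∀ i, SMulCommClass R (A i) (A i)]

theorem factors_and_splits_of_hasUnitKernel {f : (∀ i, A i) →ₙₐ[R] B}
    (hf : Function.Surjective f) (hnat : HasUnitKernel R B ℕ) {κ : Cardinal.{u}} (hκ : ℵ₀ ≤ κ)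
    (hker : ∀ T : Type v, Cardinal.lift.{u} #T ≤ Cardinal.lift.{v} κ → HasUnitKernel R B T) :
    FactorsThroughUltraproducts f (Order.succ κ) ∧
      ((∀ μ : Cardinal.{v}, μ.IsMeasurableCard →
          Cardinal.lift.{v} κ < Cardinal.lift.{u} μ → #I < μ) →
        SplitsOverFiniteSubproduct f) := by
  classical
  obtain ⟨n, U, hinj, hcomp, hU⟩ := exists_complete_ultrafilters hf hnat (Order.succ κ)
    fun T hT => hker T (by rwa [Cardinal.lift_succ, Order.lt_succ_iff] at hT)
  refine ⟨factorsThroughUltraproducts_of_forall_mem hinj hcomp hU, fun hμ => ?_⟩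
  have hprincipal : ∀ m, ∃ i, U m = pure i := fun m => by
    by_contra! hne
    obtain ⟨μ, hmeas, hlt, hle⟩ := exists_isMeasurableCard_of_isCardComplete hne hκ (hcomp m)
    exact (hμ μ hmeas hlt).not_ge hle
  choose i hi using hprincipal
  refine splitsOverFiniteSubproduct_of_mem (J := Finset.univ.image i) (hU _ fun m => ?_)
  rw [hi m, Ultrafilter.mem_pure]
  simp

end Factor

theorem theorem3p2
    {R : Type u} [CommRing R] [IsDomain R] [ValuationRing R]
    [Infinite (IsLocalRing.ResidueField R)]
    {I : Type v} {A : I → Type w}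
    [∀ i, NonUnitalNonAssocRing (A i)] [∀ i, Module R (A i)]
    [∀ i, IsScalarTower R (A i) (A i)] [∀ i, SMulCommClass R (A i) (A i)]
    {B : Type x} [NonUnitalNonAssocRing B] [Module R B]
    [IsScalarTower R B B] [SMulCommClass R B B] [Module.IsTorsionFree R B]
    (f : (∀ i, A i) →ₙₐ[R] B) (hf : Function.Surjective f) :
    (Cardinal.lift.{u} (Module.rank R B) < Cardinal.lift.{x} #(IsLocalRing.ResidueField R) →
      FactorsThroughUltraproducts f (Order.succ #(IsLocalRing.ResidueField R)) ∧
      ((∀ μ : Cardinal.{v}, μ.IsMeasurableCard →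
          Cardinal.lift.{v} #(IsLocalRing.ResidueField R) < Cardinal.lift.{u} μ → #I < μ) →
        SplitsOverFiniteSubproduct f)) ∧
    (Module.rank R B < 2 ^ ℵ₀ →
      FactorsThroughUltraproducts f ℵ₁ ∧
      ((∀ μ : Cardinal.{v}, μ.IsMeasurableCard → ℵ₀ < μ → #I < μ) →
        SplitsOverFiniteSubproduct f)) := by
  have hnat : Cardinal.lift.{u} (Module.rank R B) <
      Cardinal.lift.{x} #(IsLocalRing.ResidueField R) → HasUnitKernel R B ℕ := fun hrank =>
    hasUnitKernel_of_rank_lt_card hrank (Infinite.natEmbedding _).injective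
  refine ⟨fun hrank => ?_, fun hrank => ?_⟩
  · refine factors_and_splits_of_hasUnitKernel hf (hnat hrank)
      (Cardinal.aleph0_le_mk _) fun T hT => ?_
    obtain ⟨g⟩ := Cardinal.lift_mk_le'.1 hT
    exact hasUnitKernel_of_rank_lt_card hrank g.injective
  · have hnat' : HasUnitKernel R B ℕ := by
      -- A small residue field needs the cardinality count for ultrapowers; a large one already
      -- satisfies the rank hypothesis of the first case.
      rcases lt_or_ge #(IsLocalRing.ResidueField R) (2 ^ ℵ₀) with hk | hk
      · exact hasUnitKernel_nat_of_rank_lt hrank hk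
      · refine hnat (lt_of_lt_of_le (Cardinal.lift_lt.{_, u}.2 hrank) ?_)
        have := Cardinal.lift_le.{x}.2 hk
        simpa using this
    have := factors_and_splits_of_hasUnitKernel hf hnat' (le_refl ℵ₀) fun T hT => by
      have hcount : #T ≤ ℵ₀ := by simpa using hT
      obtain ⟨g, hg⟩ := (Cardinal.mk_le_aleph0_iff.1 hcount).exists_injective_nat
      exact hnat'.of_injective hg
    rw [Cardinal.succ_aleph0] at this
    exact ⟨this.1, fun hμ => this.2 fun μ hmeas hlt => hμ μ hmeas (by simpa using hlt)⟩
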